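/- All manifolds and tensor fields are smooth. An \emph{almost contact metric structure} $(\varphi,\xi,\eta,g)$ on a manifold $M$ of dimension $2n+1$ consists of a $(1,1)$-tensor field $\varphi$, a vector field $\xi$, a $1$-form $\eta$ and a Riemannian metric $g$ with $\varphi^2=-I+\eta\otimes\xi$, $\eta(\xi)=1$, $\varphi\xi=0$, $\eta\circ\varphi=0$ and $g(\varphi X,\varphi Y)=g(X,Y)-\eta(X)\eta(Y)$; its fundamental $2$-form is $\Phi(X,Y)=g(X,\varphi Y)$. It is \emph{almost cosymplectic} if $d\eta=0$ and $d\Phi=0$, and \emph{almost $\alpha$-Kenmotsu}, for a real constant $\alpha\neq 0$, if $d\eta=0$ and $d\Phi=2\alpha\,\eta\wedge\Phi$. In the latter case put $h'=\frac{1}{2\alpha}(\mathcal L_\xi\varphi)\circ\varphi$, where $\mathcal L$ is the Lie derivative. Let $R_{XY}=[\nabla_X,\nabla_Y]-\nabla_{[X,Y]}$ be the Riemannian curvature of $g$. The field $\xi$ \emph{belongs to the $(\kappa,\mu)'$-nullity distribution} ($\kappa,\mu\in\mathbb R$) if $$R_{XY}\xi=\kappa(\eta(Y)X-\eta(X)Y)+\mu(\eta(Y)h'X-\eta(X)h'Y)$$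 for all vector fields $X,Y$, and \emph{to the $\kappa$-nullity distribution} of $g$ if $R_{XY}\xi=\kappa(g(Y,\xi)X-g(X,\xi)Y)$ for all $X,Y$. \textbf{Proposition.} Let $(M^{2n+1},\varphi,\xi,\eta,g)$ be an almost $\alpha$-Kenmotsu manifold such that $h'\neq 0$ (that is, $h'$ is not identically zero) and $\xi$ belongs to the $(\kappa,\mu)'$-nullity distribution with $\mu=-2\alpha^2$. Then every point of $M$ has an open neighbourhood carrying a smooth function $t$ with $dt=\eta$. Moreover, for every open set $U\subseteq M$ and every smooth function $t$ on $U$ with $dt=\eta$, let $$g'=e^{-2\alpha t}g+(1-e^{-2\alpha t})\,\eta\otimes\eta$$ on $U$. Then $g'$ is a Riemannian metric on $U$, $(\varphi,\xi,\eta,g')$ is an almost cosymplectic structure on $U$, and $\xi$ belongs to the $\kappa_c$-nullity distribution of $g'$, where $\kappa_c=\kappa+\alpha^2$. -/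

import Mathlib

open Bundle Set
open scoped Manifold ContDiff Topology

noncomputable section

namespace AlmostContact

/-- The model space of a manifold of dimension `2n+1`. -/
abbrev Model (n : ℕ) : Type := EuclideanSpace ℝ (Fin (2 * n + 1))

section Defs

variable {n : ℕ} {M : Type*} [TopologicalSpace M] [ChartedSpace (Model n) M]

/-- The tangent space of `M` at `x`. -/
abbrev T (n : ℕ) {M : Type*} [TopologicalSpace M] [ChartedSpace (Model n) M] (x : M) : Type :=
  TangentSpace 𝓘(ℝ, Model n) x

/-- (Not necessarily smooth) vector fields on `M`. -/
abbrev VectorFields (n : ℕ) (M : Type*) [TopologicalSpace M] [ChartedSpace (Model n) M] : Type _ :=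
  (x : M) → T n x

/-- (Not necessarily smooth) `1`-forms on `M`. -/
abbrev OneForms (n : ℕ) (M : Type*) [TopologicalSpace M] [ChartedSpace (Model n) M] : Type _ :=
  (x : M) → (T n x →L[ℝ] ℝ)

/-- (Not necessarily smooth) tensor fields of type `(1,1)` on `M`. -/
abbrev EndFields (n : ℕ) (M : Type*) [TopologicalSpace M] [ChartedSpace (Model n) M] : Type _ :=
  (x : M) → (T n x →L[ℝ] T n x)

/-- (Not necessarily smooth) tensor fields of type `(0,2)` on `M`. -/
abbrev BilinFields (n : ℕ) (M : Type*) [TopologicalSpace M] [ChartedSpace (Model n) M] : Type _ :=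
  (x : M) → (T n x →L[ℝ] T n x →L[ℝ] ℝ)

/-- (Not necessarily smooth) `2`-forms on `M`, as functions of two tangent vectors. -/
abbrev TwoForms (n : ℕ) (M : Type*) [TopologicalSpace M] [ChartedSpace (Model n) M] : Type _ :=
  (x : M) → T n x → T n x → ℝ

variable [IsManifold 𝓘(ℝ, Model n) ∞ M]

/-! ### Smoothness of tensor fields -/

/-- The vector field `X` is smooth at `x`. -/
def SmoothFieldAt (X : VectorFields n M) (x : M) : Prop :=
  ContMDiffAt 𝓘(ℝ, Model n) (𝓘(ℝ, Model n).prod 𝓘(ℝ, Model n)) ∞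
    (fun y => TotalSpace.mk' (Model n) (E := fun y : M => T n y) y (X y)) x

/-- The vector field `X` is smooth on `U`. -/
def SmoothFieldOn (X : VectorFields n M) (U : Set M) : Prop :=
  ContMDiffOn 𝓘(ℝ, Model n) (𝓘(ℝ, Model n).prod 𝓘(ℝ, Model n)) ∞
    (fun y => TotalSpace.mk' (Model n) (E := fun y : M => T n y) y (X y)) U

/-- The `1`-form `η` is smooth on `U`. -/
def SmoothOneFormOn (η : OneForms n M) (U : Set M) : Prop :=
  ContMDiffOn 𝓘(ℝ, Model n) (𝓘(ℝ, Model n).prod 𝓘(ℝ, Model n →L[ℝ] ℝ)) ∞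
    (fun y => TotalSpace.mk' (Model n →L[ℝ] ℝ)
      (E := fun y : M => T n y →L[ℝ] ℝ) y (η y)) U

/-- The `(1,1)`-tensor field `φ` is smooth on `U`. -/
def SmoothEndOn (φ : EndFields n M) (U : Set M) : Prop :=
  ContMDiffOn 𝓘(ℝ, Model n) (𝓘(ℝ, Model n).prod 𝓘(ℝ, Model n →L[ℝ] Model n)) ∞
    (fun y => TotalSpace.mk' (Model n →L[ℝ] Model n)
      (E := fun y : M => T n y →L[ℝ] T n y) y (φ y)) U

/-- The `(0,2)`-tensor field `g` is smooth on `U`. -/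
def SmoothBilinOn (g : BilinFields n M) (U : Set M) : Prop :=
  ContMDiffOn 𝓘(ℝ, Model n) (𝓘(ℝ, Model n).prod 𝓘(ℝ, Model n →L[ℝ] Model n →L[ℝ] ℝ)) ∞
    (fun y => TotalSpace.mk' (Model n →L[ℝ] Model n →L[ℝ] ℝ)
      (E := fun y : M => T n y →L[ℝ] T n y →L[ℝ] ℝ) y (g y)) U

/-- `g` is a (smooth) Riemannian metric on `U`. -/
structure IsRiemannianMetricOn (g : BilinFields n M) (U : Set M) : Prop where
  smooth : SmoothBilinOn g U
  symm : ∀ x ∈ U, ∀ v w : T n x, g x v w = g x w v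
  pos : ∀ x ∈ U, ∀ v : T n x, v ≠ 0 → 0 < g x v v

/-! ### Brackets, exterior derivatives -/

/-- The Lie bracket `[X, Y]` of vector fields. -/
def bracket (X Y : VectorFields n M) : VectorFields n M :=
  VectorField.mlieBracket 𝓘(ℝ, Model n) X Y

/-- The derivative `X f` of the function `f` in the direction of the vector field `X`, at `x`. -/
def dirDeriv (X : VectorFields n M) (f : M → ℝ) (x : M) : ℝ :=
  mvfderiv 𝓘(ℝ, Model n) f x (X x)

/-- `dη = 0` on `U`. -/
def IsClosedOneFormOn (η : OneForms n M) (U : Set M) : Prop :=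
  ∀ x ∈ U, ∀ X Y : VectorFields n M, SmoothFieldAt X x → SmoothFieldAt Y x →
    dirDeriv X (fun y => η y (Y y)) x - dirDeriv Y (fun y => η y (X y)) x
      - η x (bracket X Y x) = 0

/-- The exterior derivative `dΦ(X, Y, Z)` at `x` of the `2`-form `Φ`, through the invariant
formula. -/
def extDerivTwo (Φ : TwoForms n M) (X Y Z : VectorFields n M) (x : M) : ℝ :=
  dirDeriv X (fun y => Φ y (Y y) (Z y)) x + dirDeriv Y (fun y => Φ y (Z y) (X y)) x
    + dirDeriv Z (fun y => Φ y (X y) (Y y)) x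
    - Φ x (bracket X Y x) (Z x) - Φ x (bracket Y Z x) (X x) - Φ x (bracket Z X x) (Y x)

/-- The wedge product `(η ∧ Φ)(u, v, w)` at `x` of a `1`-form and a `2`-form, in the normalization
that matches `extDerivTwo`. -/
def wedgeOneTwo (η : OneForms n M) (Φ : TwoForms n M) (x : M) (u v w : T n x) : ℝ :=
  η x u * Φ x v w + η x v * Φ x w u + η x w * Φ x u v

/-! ### The Levi-Civita connection and its curvature -/

/-- The right-hand side of the Koszul formula, which is `2 g(∇_X Y, Z)` at `x`. -/
def koszul (g : BilinFields n M) (X Y Z : VectorFields n M) (x : M) : ℝ :=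
  dirDeriv X (fun y => g y (Y y) (Z y)) x + dirDeriv Y (fun y => g y (Z y) (X y)) x
    - dirDeriv Z (fun y => g y (X y) (Y y)) x
    + g x (bracket X Y x) (Z x) - g x (bracket Y Z x) (X x) + g x (bracket Z X x) (Y x)

open Classical in
/-- The Levi-Civita connection `∇_X Y` of `g`: its value at `x` is the vector `w` with
`2 g(w, Z) = koszul g X Y Z` for all vector fields `Z` smooth at `x`. This vector exists and is
unique when `g` is a Riemannian metric near `x` and `X`, `Y` are differentiable at `x`. -/
def leviCivita (g : BilinFields n M) (X Y : VectorFields n M) : VectorFields n M := fun x =>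
  if h : ∃ w : T n x, ∀ Z : VectorFields n M, SmoothFieldAt Z x →
      2 * g x w (Z x) = koszul g X Y Z x
  then h.choose else 0

/-- The Riemannian curvature `R_{XY}Z = ∇_X ∇_Y Z - ∇_Y ∇_X Z - ∇_{[X,Y]} Z` of `g`. -/
def curvature (g : BilinFields n M) (X Y Z : VectorFields n M) : VectorFields n M := fun x =>
  leviCivita g X (leviCivita g Y Z) x - leviCivita g Y (leviCivita g X Z) x
    - leviCivita g (bracket X Y) Z x

/-! ### Almost contact metric structures -/

/-- `(φ, ξ, η, g)` is an almost contact metric structure on `U`. -/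
structure IsAlmostContactMetricOn (φ : EndFields n M) (ξ : VectorFields n M) (η : OneForms n M)
    (g : BilinFields n M) (U : Set M) : Prop where
  smooth_φ : SmoothEndOn φ U
  smooth_ξ : SmoothFieldOn ξ U
  smooth_η : SmoothOneFormOn η U
  metric : IsRiemannianMetricOn g U
  φ_sq : ∀ x ∈ U, ∀ v : T n x, φ x (φ x v) = -v + η x v • ξ x
  η_ξ : ∀ x ∈ U, η x (ξ x) = 1
  φ_ξ : ∀ x ∈ U, φ x (ξ x) = 0
  η_φ : ∀ x ∈ U, ∀ v : T n x, η x (φ x v) = 0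
  compat : ∀ x ∈ U, ∀ v w : T n x, g x (φ x v) (φ x w) = g x v w - η x v * η x w

/-- The fundamental `2`-form `Φ(X, Y) = g(X, φ Y)`. -/
def fundamentalForm (φ : EndFields n M) (g : BilinFields n M) : TwoForms n M :=
  fun x v w => g x v (φ x w)

/-- `(φ, ξ, η, g)` is an almost `α`-Kenmotsu structure on `U`:
`dη = 0` and `dΦ = 2α η ∧ Φ`, with `α ≠ 0`. -/
structure IsAlmostKenmotsuOn (α : ℝ) (φ : EndFields n M) (ξ : VectorFields n M)
    (η : OneForms n M) (g : BilinFields n M) (U : Set M) : Prop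
    extends IsAlmostContactMetricOn φ ξ η g U where
  α_ne_zero : α ≠ 0
  dη : IsClosedOneFormOn η U
  dΦ : ∀ x ∈ U, ∀ X Y Z : VectorFields n M,
    SmoothFieldAt X x → SmoothFieldAt Y x → SmoothFieldAt Z x →
      extDerivTwo (fundamentalForm φ g) X Y Z x
        = 2 * α * wedgeOneTwo η (fundamentalForm φ g) x (X x) (Y x) (Z x)

/-- `(φ, ξ, η, g)` is an almost cosymplectic structure on `U`: `dη = 0` and `dΦ = 0`. -/
structure IsAlmostCosymplecticOn (φ : EndFields n M) (ξ : VectorFields n M)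
    (η : OneForms n M) (g : BilinFields n M) (U : Set M) : Prop
    extends IsAlmostContactMetricOn φ ξ η g U where
  dη : IsClosedOneFormOn η U
  dΦ : ∀ x ∈ U, ∀ X Y Z : VectorFields n M,
    SmoothFieldAt X x → SmoothFieldAt Y x → SmoothFieldAt Z x →
      extDerivTwo (fundamentalForm φ g) X Y Z x = 0

/-- The Lie derivative `(L_ξ φ) Y = [ξ, φ Y] - φ [ξ, Y]`. -/
def lieDerivEnd (ξ : VectorFields n M) (φ : EndFields n M) (Y : VectorFields n M) :
    VectorFields n M :=
  fun x => bracket ξ (fun y => φ y (Y y)) x - φ x (bracket ξ Y x)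

/-- The operator `h' = (1 / 2α) (L_ξ φ) ∘ φ`, acting on vector fields. -/
def hPrime (α : ℝ) (φ : EndFields n M) (ξ : VectorFields n M) (X : VectorFields n M) :
    VectorFields n M :=
  fun x => (1 / (2 * α)) • lieDerivEnd ξ φ (fun y => φ y (X y)) x

/-- `ξ` belongs to the `(κ, μ)'`-nullity distribution on `U`. -/
def InKMNullityOn (κ μ α : ℝ) (φ : EndFields n M) (ξ : VectorFields n M) (η : OneForms n M)
    (g : BilinFields n M) (U : Set M) : Prop :=
  ∀ x ∈ U, ∀ X Y : VectorFields n M, SmoothFieldAt X x → SmoothFieldAt Y x →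
    curvature g X Y ξ x = κ • (η x (Y x) • X x - η x (X x) • Y x)
      + μ • (η x (Y x) • hPrime α φ ξ X x - η x (X x) • hPrime α φ ξ Y x)

/-- `ξ` belongs to the `κ`-nullity distribution of the metric `g` on `U`. -/
def InNullityOn (κ : ℝ) (ξ : VectorFields n M) (g : BilinFields n M) (U : Set M) : Prop :=
  ∀ x ∈ U, ∀ X Y : VectorFields n M, SmoothFieldAt X x → SmoothFieldAt Y x →
    curvature g X Y ξ x = κ • (g x (Y x) (ξ x) • X x - g x (X x) (ξ x) • Y x)

/-- `t` is a smooth function on `U` with `dt = η`. -/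
def IsPrimitiveOn (t : M → ℝ) (η : OneForms n M) (U : Set M) : Prop :=
  ContMDiffOn 𝓘(ℝ, Model n) 𝓘(ℝ, ℝ) ∞ t U ∧
    ∀ x ∈ U, mvfderiv 𝓘(ℝ, Model n) t x = η x

/-- The `D`-conformal change `g' = e^{-2αt} g + (1 - e^{-2αt}) η ⊗ η`. -/
def conformalChange (α : ℝ) (t : M → ℝ) (η : OneForms n M) (g : BilinFields n M) :
    BilinFields n M :=
  fun x => Real.exp (-2 * α * t x) • g x
    + (1 - Real.exp (-2 * α * t x)) • (η x).smulRight (η x)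

end Defs

end AlmostContact

end

noncomputable section

namespace AlmostContact

variable {n : ℕ} {M : Type*} [TopologicalSpace M] [ChartedSpace (Model n) M]
  [IsManifold 𝓘(ℝ, Model n) ∞ M]

/-! Local primitives of η come from the Poincaré lemma in a chart. For the rest, put E = e^{-2αt},
so that dE = -2αEη. Since η∘φ = 0, the new fundamental form is EΦ, and the derivative of the factor
E cancels dΦ = 2αη∧Φ.

For the curvature, closedness of η together with L_ξΦ = 2αΦ determines ∇ξ: ∇_Xξ = α(X - η(X)ξ + h'X)
(`leviCivita_ξ`). The Koszul formula for g' exhibits ∇' as ∇ plus a tensor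
(`leviCivita_conformalChange`), which on ξ removes everything but h': ∇'_Xξ = αh'X
(`leviCivita_conformalChange_ξ`).

In R'_{XY}ξ - R_{XY}ξ the derivatives of h' cancel, and so do the ξ-components, because h' is
self-adjoint and η is closed. What is left is α²(η(Y)X - η(X)Y) + 2α²(η(Y)h'X - η(X)h'Y)
(`curvature_conformalChange`). This holds on every almost α-Kenmotsu manifold; the nullity condition
is only substituted at the end, where μ = -2α² is exactly the value that kills the h' terms and κ
becomes κ + α². -/

instance : IsManifold 𝓘(ℝ, Model n) (minSmoothness ℝ 2) M :=
  IsManifold.of_le (n := ∞) (by simpa using ENat.LEInfty.out)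

/-! ### Differentiable fields -/

/-- The vector field `X` is differentiable at `x`. -/
def DiffFieldAt (X : VectorFields n M) (x : M) : Prop :=
  MDifferentiableAt 𝓘(ℝ, Model n) (𝓘(ℝ, Model n).prod 𝓘(ℝ, Model n))
    (fun y => TotalSpace.mk' (Model n) (E := fun y : M => T n y) y (X y)) x

/-- The real function `f` is differentiable at `x`. -/
abbrev DiffFunAt (n : ℕ) {M : Type*} [TopologicalSpace M] [ChartedSpace (Model n) M]
    (f : M → ℝ) (x : M) : Prop :=
  MDifferentiableAt 𝓘(ℝ, Model n) 𝓘(ℝ, ℝ) f x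

/-- The real function `f` is smooth at `x`. -/
abbrev SmoothFunAt (n : ℕ) {M : Type*} [TopologicalSpace M] [ChartedSpace (Model n) M]
    (f : M → ℝ) (x : M) : Prop :=
  ContMDiffAt 𝓘(ℝ, Model n) 𝓘(ℝ, ℝ) ∞ f x

variable {x : M} {X Y Z W : VectorFields n M} {f h : M → ℝ}

omit [IsManifold 𝓘(ℝ, Model n) ∞ M] in
theorem SmoothFunAt.diff (hf : SmoothFunAt n f x) : DiffFunAt n f x :=
  hf.mdifferentiableAt (by simp)

omit [IsManifold 𝓘(ℝ, Model n) ∞ M] in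
theorem DiffFunAt.mul (hf : DiffFunAt n f x) (hh : DiffFunAt n h x) :
    DiffFunAt n (fun y => f y * h y) x :=
  MDifferentiableAt.mul hf hh

omit [IsManifold 𝓘(ℝ, Model n) ∞ M] in
theorem diffFunAt_const (c : ℝ) : DiffFunAt n (fun _ => c) x :=
  mdifferentiableAt_const

theorem SmoothFieldAt.diff (hX : SmoothFieldAt X x) : DiffFieldAt X x :=
  ContMDiffAt.mdifferentiableAt hX (by simp)

/-- Being C^∞ at a point does not spread to a neighbourhood, since the neighbourhood may shrink with
the order; being C^1 does. Identities that have to be differentiated must hold near the point, so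
they are proved for merely differentiable fields. -/
theorem SmoothFieldAt.eventually_diff (hX : SmoothFieldAt X x) :
    ∀ᶠ y in 𝓝 x, DiffFieldAt X y := by
  have h0 : ContMDiffAt 𝓘(ℝ, Model n) (𝓘(ℝ, Model n).prod 𝓘(ℝ, Model n)) 1
      (fun y => TotalSpace.mk' (Model n) (E := fun y : M => T n y) y (X y)) x :=
    ContMDiffAt.of_le hX (by simp)
  have h1 := (contMDiffAt_iff_contMDiffAt_nhds (by simp)).1 h0
  exact h1.mono fun y hy => hy.mdifferentiableAt (by simp)

theorem SmoothFieldOn.at {U : Set M} (hX : SmoothFieldOn X U) (hU : IsOpen U) (hx : x ∈ U) :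
    SmoothFieldAt X x :=
  ContMDiffOn.contMDiffAt hX (hU.mem_nhds hx)

/-- A tangent vector extends to a vector field that is smooth at its base point. -/
theorem exists_smoothFieldAt (v : T n x) : ∃ X : VectorFields n M, SmoothFieldAt X x ∧ X x = v :=
  ⟨FiberBundle.extend (Model n) v, FiberBundle.contMDiffAt_extend _ _ v, by simp⟩

theorem SmoothFieldAt.sub (hX : SmoothFieldAt X x) (hY : SmoothFieldAt Y x) :
    SmoothFieldAt (fun y => X y - Y y) x :=
  ContMDiffAt.sub_section hX hY

theorem SmoothFieldAt.const_smul (c : ℝ) (hX : SmoothFieldAt X x) :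
    SmoothFieldAt (fun y => c • X y) x :=
  ContMDiffAt.const_smul_section hX

theorem SmoothFieldAt.bracket (hX : SmoothFieldAt X x) (hY : SmoothFieldAt Y x) :
    SmoothFieldAt (bracket X Y) x := by
  have : IsManifold 𝓘(ℝ, Model n) ((∞ : ℕ∞ω) + 1) M := by simpa using ‹_›
  exact ContMDiffAt.mlieBracket_vectorField (m := (⊤ : ℕ∞)) (n := (⊤ : ℕ∞)) hX hY (by simp)

theorem DiffFieldAt.add (hX : DiffFieldAt X x) (hY : DiffFieldAt Y x) :
    DiffFieldAt (fun y => X y + Y y) x :=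
  mdifferentiableAt_add_section hX hY

theorem DiffFieldAt.smul (hf : DiffFunAt n f x) (hX : DiffFieldAt X x) :
    DiffFieldAt (fun y => f y • X y) x :=
  MDifferentiableAt.smul_section hf hX

/-! ### Contractions -/

section contractions

variable {U : Set M} {g : BilinFields n M} {η : OneForms n M} {φ : EndFields n M}

theorem SmoothBilinOn.smooth_apply (hg : SmoothBilinOn g U) (hU : IsOpen U) (hx : x ∈ U)
    (hX : SmoothFieldAt X x) (hY : SmoothFieldAt Y x) :
    SmoothFunAt n (fun y => g y (X y) (Y y)) x := by
  have := ContMDiffAt.clm_bundle_apply₂ (F₁ := Model n) (F₂ := Model n) (F₃ := ℝ)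
    (E₁ := fun y : M => T n y) (E₂ := fun y : M => T n y) (E₃ := fun _ : M => ℝ)
    (b := fun y : M => y) (ContMDiffOn.contMDiffAt hg (hU.mem_nhds hx)) hX hY
  exact (contMDiffAt_totalSpace.1 this).2

theorem SmoothBilinOn.diff_apply (hg : SmoothBilinOn g U) (hU : IsOpen U) (hx : x ∈ U)
    (hX : DiffFieldAt X x) (hY : DiffFieldAt Y x) :
    DiffFunAt n (fun y => g y (X y) (Y y)) x := by
  have := MDifferentiableAt.clm_bundle_apply₂ (F₁ := Model n) (F₂ := Model n) (F₃ := ℝ)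
    (E₁ := fun y : M => T n y) (E₂ := fun y : M => T n y) (E₃ := fun _ : M => ℝ)
    (b := fun y : M => y) ((ContMDiffOn.contMDiffAt hg (hU.mem_nhds hx)).mdifferentiableAt (by simp))
    hX hY
  exact ((mdifferentiableAt_totalSpace _ _).1 this).2

theorem SmoothOneFormOn.smooth_apply (hη : SmoothOneFormOn η U) (hU : IsOpen U) (hx : x ∈ U)
    (hX : SmoothFieldAt X x) : SmoothFunAt n (fun y => η y (X y)) x := by
  have := ContMDiffAt.clm_bundle_apply (F₁ := Model n) (F₂ := ℝ)
    (E₁ := fun y : M => T n y) (E₂ := fun _ : M => ℝ)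
    (b := fun y : M => y) (ContMDiffOn.contMDiffAt hη (hU.mem_nhds hx)) hX
  exact (contMDiffAt_totalSpace.1 this).2

theorem SmoothOneFormOn.diff_apply (hη : SmoothOneFormOn η U) (hU : IsOpen U) (hx : x ∈ U)
    (hX : DiffFieldAt X x) : DiffFunAt n (fun y => η y (X y)) x := by
  have := MDifferentiableAt.clm_bundle_apply (F₁ := Model n) (F₂ := ℝ)
    (E₁ := fun y : M => T n y) (E₂ := fun _ : M => ℝ)
    (b := fun y : M => y) ((ContMDiffOn.contMDiffAt hη (hU.mem_nhds hx)).mdifferentiableAt (by simp)) hX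
  exact ((mdifferentiableAt_totalSpace _ _).1 this).2

theorem SmoothEndOn.smooth_apply (hφ : SmoothEndOn φ U) (hU : IsOpen U) (hx : x ∈ U)
    (hX : SmoothFieldAt X x) : SmoothFieldAt (fun y => φ y (X y)) x :=
  ContMDiffAt.clm_bundle_apply (F₁ := Model n) (F₂ := Model n)
    (E₁ := fun y : M => T n y) (E₂ := fun y : M => T n y)
    (b := fun y : M => y) (ContMDiffOn.contMDiffAt hφ (hU.mem_nhds hx)) hX

theorem SmoothEndOn.diff_apply (hφ : SmoothEndOn φ U) (hU : IsOpen U) (hx : x ∈ U)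
    (hX : DiffFieldAt X x) : DiffFieldAt (fun y => φ y (X y)) x :=
  MDifferentiableAt.clm_bundle_apply (F₁ := Model n) (F₂ := Model n)
    (E₁ := fun y : M => T n y) (E₂ := fun y : M => T n y)
    (b := fun y : M => y) ((ContMDiffOn.contMDiffAt hφ (hU.mem_nhds hx)).mdifferentiableAt (by simp))
    hX

end contractions

/-! ### Rules for directional derivatives and brackets -/

omit [IsManifold 𝓘(ℝ, Model n) ∞ M] in
theorem dirDeriv_add (X : VectorFields n M) (hf : DiffFunAt n f x) (hh : DiffFunAt n h x) :
    dirDeriv X (fun y => f y + h y) x = dirDeriv X f x + dirDeriv X h x := by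
  simp [dirDeriv, mvfderiv_fun_add hf hh]

omit [IsManifold 𝓘(ℝ, Model n) ∞ M] in
theorem dirDeriv_sub (X : VectorFields n M) (hf : DiffFunAt n f x) (hh : DiffFunAt n h x) :
    dirDeriv X (fun y => f y - h y) x = dirDeriv X f x - dirDeriv X h x := by
  simp [dirDeriv, mvfderiv_fun_sub hf hh]

omit [IsManifold 𝓘(ℝ, Model n) ∞ M] in
theorem dirDeriv_mul (X : VectorFields n M) (hf : DiffFunAt n f x) (hh : DiffFunAt n h x) :
    dirDeriv X (fun y => f y * h y) x = f x * dirDeriv X h x + h x * dirDeriv X f x := by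
  simp [dirDeriv, mvfderiv_fun_mul hf hh]

omit [IsManifold 𝓘(ℝ, Model n) ∞ M] in
theorem dirDeriv_const (X : VectorFields n M) (c : ℝ) : dirDeriv X (fun _ => c) x = 0 := by
  simp [dirDeriv, mvfderiv_const]

omit [IsManifold 𝓘(ℝ, Model n) ∞ M] in
theorem dirDeriv_congr (X : VectorFields n M) (hfh : ∀ᶠ y in 𝓝 x, f y = h y) :
    dirDeriv X f x = dirDeriv X h x := by
  have : mfderiv 𝓘(ℝ, Model n) 𝓘(ℝ, ℝ) f x = mfderiv 𝓘(ℝ, Model n) 𝓘(ℝ, ℝ) h x :=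
    Filter.EventuallyEq.mfderiv_eq hfh
  simp only [dirDeriv, mvfderiv]
  have h0 := hfh.self_of_nhds
  congr 1

omit [IsManifold 𝓘(ℝ, Model n) ∞ M] in
theorem dirDeriv_add_left (X Y : VectorFields n M) (f : M → ℝ) :
    dirDeriv (X + Y) f x = dirDeriv X f x + dirDeriv Y f x := by
  simp [dirDeriv]

omit [IsManifold 𝓘(ℝ, Model n) ∞ M] in
theorem dirDeriv_smul_left (h : M → ℝ) (X : VectorFields n M) (f : M → ℝ) :
    dirDeriv (h • X) f x = h x * dirDeriv X f x := by
  simp [dirDeriv]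

omit [IsManifold 𝓘(ℝ, Model n) ∞ M] in
theorem bracket_swap (X Y : VectorFields n M) (x : M) : bracket X Y x = -bracket Y X x :=
  VectorField.mlieBracket_swap_apply

theorem bracket_add_right (hY : DiffFieldAt Y x) (hZ : DiffFieldAt Z x) :
    bracket X (Y + Z) x = bracket X Y x + bracket X Z x :=
  VectorField.mlieBracket_add_right hY hZ

theorem bracket_add_left (hY : DiffFieldAt Y x) (hZ : DiffFieldAt Z x) :
    bracket (Y + Z) X x = bracket Y X x + bracket Z X x :=
  VectorField.mlieBracket_add_left hY hZ

theorem bracket_smul_right (hf : DiffFunAt n f x) (hY : DiffFieldAt Y x) :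
    bracket X (f • Y) x = dirDeriv X f x • Y x + f x • bracket X Y x :=
  VectorField.mlieBracket_smul_right hf hY

theorem bracket_smul_left (hf : DiffFunAt n f x) (hY : DiffFieldAt Y x) :
    bracket (f • Y) X x = -dirDeriv X f x • Y x + f x • bracket Y X x :=
  VectorField.mlieBracket_smul_left hf hY

omit [IsManifold 𝓘(ℝ, Model n) ∞ M] in
theorem bracket_congr_right (X : VectorFields n M) (hYZ : ∀ᶠ y in 𝓝 x, Y y = Z y) :
    bracket X Y x = bracket X Z x :=
  Filter.EventuallyEq.mlieBracket_vectorField_eq (Filter.EventuallyEq.refl _ _) hYZ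

/-! ### The Koszul formula -/

section levi_civita

variable {x : M} {X X' Y Y' Z : VectorFields n M} {f : M → ℝ} {U : Set M} {g : BilinFields n M}

/-- The terms in Xf and Yf produced by the Leibniz rule cancel against those of the brackets [Z, X]
and [Y, Z]; one of the two cancellations needs the symmetry of g at the point. -/
theorem koszul_smul_third (hg : SmoothBilinOn g U) (hU : IsOpen U) (hx : x ∈ U)
    (hX : DiffFieldAt X x) (hY : DiffFieldAt Y x) (hf : DiffFunAt n f x) (hZ : DiffFieldAt Z x)
    (hs : ∀ v w : T n x, g x v w = g x w v) :
    koszul g X Y (f • Z) x = f x * koszul g X Y Z x := by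
  have e1 : (fun y => g y (Y y) ((f • Z) y)) = fun y => f y * g y (Y y) (Z y) := by
    ext; simp
  have e2 : (fun y => g y ((f • Z) y) (X y)) = fun y => f y * g y (Z y) (X y) := by
    ext; simp
  simp only [koszul, e1, e2, dirDeriv_mul _ hf (hg.diff_apply hU hx hY hZ),
    dirDeriv_mul _ hf (hg.diff_apply hU hx hZ hX), dirDeriv_smul_left,
    bracket_smul_right hf hZ, bracket_smul_left hf hZ]
  simp only [Pi.smul_apply', map_add, map_smul, _root_.add_apply,
    _root_.smul_apply, smul_eq_mul, hs (Y x) (Z x)]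
  ring

theorem koszul_add_third (hg : SmoothBilinOn g U) (hU : IsOpen U) (hx : x ∈ U)
    (hX : DiffFieldAt X x) (hY : DiffFieldAt Y x) {Z' : VectorFields n M} (hZ : DiffFieldAt Z x)
    (hZ' : DiffFieldAt Z' x) :
    koszul g X Y (Z + Z') x = koszul g X Y Z x + koszul g X Y Z' x := by
  have e1 : (fun y => g y (Y y) ((Z + Z') y))
      = fun y => g y (Y y) (Z y) + g y (Y y) (Z' y) := by ext; simp
  have e2 : (fun y => g y ((Z + Z') y) (X y))
      = fun y => g y (Z y) (X y) + g y (Z' y) (X y) := by ext; simp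
  simp only [koszul, e1, e2, dirDeriv_add _ (hg.diff_apply hU hx hY hZ)
    (hg.diff_apply hU hx hY hZ'), dirDeriv_add _ (hg.diff_apply hU hx hZ hX)
    (hg.diff_apply hU hx hZ' hX), dirDeriv_add_left,
    bracket_add_right hZ hZ', bracket_add_left hZ hZ']
  simp only [Pi.add_apply, map_add, _root_.add_apply]
  ring

theorem koszul_smul_first (hg : SmoothBilinOn g U) (hU : IsOpen U) (hx : x ∈ U)
    (hX : DiffFieldAt X x) (hY : DiffFieldAt Y x) (hf : DiffFunAt n f x) (hZ : DiffFieldAt Z x)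
    (hs : ∀ v w : T n x, g x v w = g x w v) :
    koszul g (f • X) Y Z x = f x * koszul g X Y Z x := by
  have e1 : (fun y => g y ((f • X) y) (Y y)) = fun y => f y * g y (X y) (Y y) := by
    ext; simp
  have e2 : (fun y => g y (Z y) ((f • X) y)) = fun y => f y * g y (Z y) (X y) := by
    ext; simp
  simp only [koszul, e1, e2, dirDeriv_mul _ hf (hg.diff_apply hU hx hX hY),
    dirDeriv_mul _ hf (hg.diff_apply hU hx hZ hX), dirDeriv_smul_left,
    bracket_smul_right hf hX, bracket_smul_left hf hX]
  simp only [Pi.smul_apply', map_add, map_smul, _root_.add_apply,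
    _root_.smul_apply, smul_eq_mul, hs (Z x) (X x)]
  ring

theorem koszul_add_first (hg : SmoothBilinOn g U) (hU : IsOpen U) (hx : x ∈ U)
    (hX : DiffFieldAt X x) (hX' : DiffFieldAt X' x) (hY : DiffFieldAt Y x)
    (hZ : DiffFieldAt Z x) :
    koszul g (X + X') Y Z x = koszul g X Y Z x + koszul g X' Y Z x := by
  have e1 : (fun y => g y ((X + X') y) (Y y))
      = fun y => g y (X y) (Y y) + g y (X' y) (Y y) := by ext; simp
  have e2 : (fun y => g y (Z y) ((X + X') y))
      = fun y => g y (Z y) (X y) + g y (Z y) (X' y) := by ext; simp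
  simp only [koszul, e1, e2, dirDeriv_add _ (hg.diff_apply hU hx hX hY)
    (hg.diff_apply hU hx hX' hY), dirDeriv_add _ (hg.diff_apply hU hx hZ hX)
    (hg.diff_apply hU hx hZ hX'), dirDeriv_add_left,
    bracket_add_right hX hX', bracket_add_left hX hX']
  simp only [Pi.add_apply, map_add, _root_.add_apply]
  ring

/-- Here the Zf terms cancel while the Xf terms add up; they become the Leibniz term of the
connection. -/
theorem koszul_smul_second (hg : SmoothBilinOn g U) (hU : IsOpen U) (hx : x ∈ U)
    (hX : DiffFieldAt X x) (hY : DiffFieldAt Y x) (hf : DiffFunAt n f x) (hZ : DiffFieldAt Z x)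
    (hs : ∀ v w : T n x, g x v w = g x w v) :
    koszul g X (f • Y) Z x = f x * koszul g X Y Z x + 2 * dirDeriv X f x * g x (Y x) (Z x) := by
  have e1 : (fun y => g y ((f • Y) y) (Z y)) = fun y => f y * g y (Y y) (Z y) := by
    ext; simp
  have e2 : (fun y => g y (X y) ((f • Y) y)) = fun y => f y * g y (X y) (Y y) := by
    ext; simp
  simp only [koszul, e1, e2, dirDeriv_mul _ hf (hg.diff_apply hU hx hY hZ),
    dirDeriv_mul _ hf (hg.diff_apply hU hx hX hY), dirDeriv_smul_left,
    bracket_smul_right hf hY, bracket_smul_left hf hY]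
  simp only [Pi.smul_apply', map_add, map_smul, _root_.add_apply,
    _root_.smul_apply, smul_eq_mul, hs (X x) (Y x)]
  ring

theorem koszul_add_second (hg : SmoothBilinOn g U) (hU : IsOpen U) (hx : x ∈ U)
    (hX : DiffFieldAt X x) (hY : DiffFieldAt Y x) (hY' : DiffFieldAt Y' x)
    (hZ : DiffFieldAt Z x) :
    koszul g X (Y + Y') Z x = koszul g X Y Z x + koszul g X Y' Z x := by
  have e1 : (fun y => g y ((Y + Y') y) (Z y))
      = fun y => g y (Y y) (Z y) + g y (Y' y) (Z y) := by ext; simp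
  have e2 : (fun y => g y (X y) ((Y + Y') y))
      = fun y => g y (X y) (Y y) + g y (X y) (Y' y) := by ext; simp
  simp only [koszul, e1, e2, dirDeriv_add _ (hg.diff_apply hU hx hY hZ)
    (hg.diff_apply hU hx hY' hZ), dirDeriv_add _ (hg.diff_apply hU hx hX hY)
    (hg.diff_apply hU hx hX hY'), dirDeriv_add_left,
    bracket_add_right hY hY', bracket_add_left hY hY']
  simp only [Pi.add_apply, map_add, _root_.add_apply]
  ring

theorem tensorialAt_koszul_third (hg : IsRiemannianMetricOn g U) (hU : IsOpen U) (hx : x ∈ U)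
    (hX : DiffFieldAt X x) (hY : DiffFieldAt Y x) :
    TensorialAt 𝓘(ℝ, Model n) (Model n) (fun Z : VectorFields n M => koszul g X Y Z x) x where
  smul hf hZ := koszul_smul_third hg.smooth hU hx hX hY hf hZ (hg.symm x hx)
  add hZ hZ' := koszul_add_third hg.smooth hU hx hX hY hZ hZ'

theorem tensorialAt_koszul_first (hg : IsRiemannianMetricOn g U) (hU : IsOpen U) (hx : x ∈ U)
    (hY : DiffFieldAt Y x) (hZ : DiffFieldAt Z x) :
    TensorialAt 𝓘(ℝ, Model n) (Model n) (fun X : VectorFields n M => koszul g X Y Z x) x where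
  smul hf hX := koszul_smul_first hg.smooth hU hx hX hY hf hZ (hg.symm x hx)
  add hX hX' := koszul_add_first hg.smooth hU hx hX hX' hY hZ

/-! ### The Levi-Civita connection -/

theorem IsRiemannianMetricOn.eq_of_forall (hg : IsRiemannianMetricOn g U) (hx : x ∈ U)
    {v w : T n x} (h : ∀ u : T n x, g x v u = g x w u) : v = w := by
  by_contra hne
  have := hg.pos x hx (v - w) (sub_ne_zero.2 hne)
  have h0 : g x (v - w) (v - w) = 0 := by rw [map_sub (g x), _root_.sub_apply, h, sub_self]
  exact this.ne' h0

theorem IsRiemannianMetricOn.exists_represents (hg : IsRiemannianMetricOn g U) (hx : x ∈ U)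
    (l : T n x →L[ℝ] ℝ) : ∃ w : T n x, ∀ u : T n x, g x w u = l u := by
  have : FiniteDimensional ℝ (T n x) := inferInstanceAs (FiniteDimensional ℝ (Model n))
  let G : T n x →ₗ[ℝ] Module.Dual ℝ (T n x) :=
    { toFun := fun v => (g x v).toLinearMap
      map_add' := fun v w => by ext u; simp
      map_smul' := fun c v => by ext u; simp }
  have hG : Function.Injective G := fun v w hvw =>
    hg.eq_of_forall hx fun u => congrArg (fun l : Module.Dual ℝ (T n x) => l u) hvw
  -- Definiteness makes v ↦ g(v, ·) injective, hence onto the dual by equality of dimensions.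
  obtain ⟨w, hw⟩ := (LinearMap.injective_iff_surjective_of_finrank_eq_finrank
    (Subspace.dual_finrank_eq).symm).1 hG l.toLinearMap
  exact ⟨w, fun u => congrArg (fun l : Module.Dual ℝ (T n x) => l u) hw⟩

/-- Nondegeneracy makes the chosen vector unique. Explicit formulas for a connection are proved
through this lemma, by testing a candidate in the Koszul formula. -/
theorem leviCivita_eq_of_forall (hg : IsRiemannianMetricOn g U) (hx : x ∈ U) {w : T n x}
    (hw : ∀ Z : VectorFields n M, SmoothFieldAt Z x → 2 * g x w (Z x) = koszul g X Y Z x) :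
    leviCivita g X Y x = w := by
  have hex : ∃ w : T n x, ∀ Z : VectorFields n M, SmoothFieldAt Z x →
      2 * g x w (Z x) = koszul g X Y Z x := ⟨w, hw⟩
  rw [leviCivita, dif_pos hex]
  refine hg.eq_of_forall hx fun u => ?_
  obtain ⟨Z, hZ, rfl⟩ := exists_smoothFieldAt u
  have h1 := hex.choose_spec Z hZ
  have h2 := hw Z hZ
  linarith

/-- Tensoriality in Z turns the Koszul expression into a linear functional on the tangent space,
which g represents. It also widens the test fields from smooth to differentiable. -/
theorem two_mul_leviCivita (hg : IsRiemannianMetricOn g U) (hU : IsOpen U) (hx : x ∈ U)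
    (hX : DiffFieldAt X x) (hY : DiffFieldAt Y x) (hZ : DiffFieldAt Z x) :
    2 * g x (leviCivita g X Y x) (Z x) = koszul g X Y Z x := by
  have ht := tensorialAt_koszul_third hg hU hx hX hY
  obtain ⟨w, hw⟩ := hg.exists_represents hx ((1 / 2 : ℝ) • TensorialAt.mkHom _ x ht)
  have key : ∀ Z : VectorFields n M, DiffFieldAt Z x →
      2 * g x w (Z x) = koszul g X Y Z x := fun Z hZ => by
    rw [hw, _root_.smul_apply, TensorialAt.mkHom_apply ht hZ, smul_eq_mul]
    ring
  rw [leviCivita_eq_of_forall hg hx fun Z hZ => key Z hZ.diff, key Z hZ]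

/-- Used to replace a differentiable direction by a smooth field with the same value, for which the
hypotheses on dη and dΦ are available. -/
theorem leviCivita_congr_first (hg : IsRiemannianMetricOn g U) (hU : IsOpen U) (hx : x ∈ U)
    (hX : DiffFieldAt X x) (hX' : DiffFieldAt X' x) (hY : DiffFieldAt Y x) (h : X x = X' x) :
    leviCivita g X Y x = leviCivita g X' Y x := by
  refine leviCivita_eq_of_forall hg hx fun Z hZ => ?_
  rw [two_mul_leviCivita hg hU hx hX' hY hZ.diff]
  exact ((tensorialAt_koszul_first hg hU hx hY hZ.diff).pointwise hX hX' h).symm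

open Classical in
theorem leviCivita_congr_second (g : BilinFields n M) (X : VectorFields n M)
    (h : ∀ᶠ y in 𝓝 x, Y y = Y' y) : leviCivita g X Y x = leviCivita g X Y' x := by
  have key : ∀ Z, koszul g X Y Z x = koszul g X Y' Z x := fun Z => by
    simp only [koszul, h.self_of_nhds, bracket_congr_right X h, bracket_swap Y Z,
      bracket_swap Y' Z, bracket_congr_right Z h]
    rw [dirDeriv_congr X (h := fun y => g y (Y' y) (Z y)) (h.mono fun y hy => by rw [hy]),
      dirDeriv_congr Z (h := fun y => g y (X y) (Y' y)) (h.mono fun y hy => by rw [hy])]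
    simp [dirDeriv, h.self_of_nhds]
  -- Equal Koszul functionals yield the same `choose`, so no uniqueness, and hence no assumption on
  -- g, is needed.
  have aux : ∀ k k' : VectorFields n M → ℝ, k = k' →
      (if h : ∃ w : T n x, ∀ Z, SmoothFieldAt Z x → 2 * g x w (Z x) = k Z then h.choose else 0)
        = if h : ∃ w : T n x, ∀ Z, SmoothFieldAt Z x → 2 * g x w (Z x) = k' Z
          then h.choose else 0 := by
    rintro k _ rfl
    rfl
  exact aux _ _ (funext key)

theorem leviCivita_add (hg : IsRiemannianMetricOn g U) (hU : IsOpen U) (hx : x ∈ U)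
    (hX : DiffFieldAt X x) (hY : DiffFieldAt Y x) (hY' : DiffFieldAt Y' x) :
    leviCivita g X (fun y => Y y + Y' y) x = leviCivita g X Y x + leviCivita g X Y' x := by
  refine leviCivita_eq_of_forall hg hx fun Z hZ => ?_
  have h1 := two_mul_leviCivita hg hU hx hX hY hZ.diff
  have h2 := two_mul_leviCivita hg hU hx hX hY' hZ.diff
  have h3 := koszul_add_second hg.smooth hU hx hX hY hY' hZ.diff
  rw [map_add, _root_.add_apply]
  change _ = koszul g X (Y + Y') Z x
  linarith

theorem leviCivita_smul (hg : IsRiemannianMetricOn g U) (hU : IsOpen U) (hx : x ∈ U)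
    (hX : DiffFieldAt X x) (hf : DiffFunAt n f x) (hY : DiffFieldAt Y x) :
    leviCivita g X (fun y => f y • Y y) x = f x • leviCivita g X Y x + dirDeriv X f x • Y x := by
  refine leviCivita_eq_of_forall hg hx fun Z hZ => ?_
  have h1 := two_mul_leviCivita hg hU hx hX hY hZ.diff
  have h3 := koszul_smul_second hg.smooth hU hx hX hY hf hZ.diff (hg.symm x hx)
  simp only [map_add, map_smul, _root_.add_apply, _root_.smul_apply,
    smul_eq_mul]
  change _ = koszul g X (f • Y) Z x
  linear_combination f x * h1 - h3

/-- The Levi-Civita connection is torsion-free. -/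
theorem leviCivita_sub_leviCivita (hg : IsRiemannianMetricOn g U) (hU : IsOpen U) (hx : x ∈ U)
    (hX : DiffFieldAt X x) (hY : DiffFieldAt Y x) :
    leviCivita g X Y x - leviCivita g Y X x = bracket X Y x := by
  refine hg.eq_of_forall hx fun u => ?_
  obtain ⟨Z, hZ, rfl⟩ := exists_smoothFieldAt u
  have h1 := two_mul_leviCivita hg hU hx hX hY hZ.diff
  have h2 := two_mul_leviCivita hg hU hx hY hX hZ.diff
  have hs : ∀ V W Z : VectorFields n M,
      dirDeriv Z (fun y => g y (V y) (W y)) x = dirDeriv Z (fun y => g y (W y) (V y)) x :=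
    fun V W Z => dirDeriv_congr Z ((hU.eventually_mem hx).mono fun y hy => hg.symm y hy _ _)
  simp only [koszul, bracket_swap Y X, bracket_swap Z X, bracket_swap Z Y, hs Z X, hs Z Y, hs Y X,
    map_neg, _root_.neg_apply] at h1 h2
  rw [map_sub, _root_.sub_apply]
  linarith

/-- The Levi-Civita connection is compatible with the metric. -/
theorem dirDeriv_metric (hg : IsRiemannianMetricOn g U) (hU : IsOpen U) (hx : x ∈ U)
    (hX : DiffFieldAt X x) (hY : DiffFieldAt Y x) (hZ : DiffFieldAt Z x) :
    dirDeriv X (fun y => g y (Y y) (Z y)) x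
      = g x (leviCivita g X Y x) (Z x) + g x (Y x) (leviCivita g X Z x) := by
  have h1 := two_mul_leviCivita hg hU hx hX hY hZ
  have h2 := two_mul_leviCivita hg hU hx hX hZ hY
  have hs : ∀ V W Z : VectorFields n M,
      dirDeriv Z (fun y => g y (V y) (W y)) x = dirDeriv Z (fun y => g y (W y) (V y)) x :=
    fun V W Z => dirDeriv_congr Z ((hU.eventually_mem hx).mono fun y hy => hg.symm y hy _ _)
  simp only [koszul, bracket_swap Y X, bracket_swap Z X, bracket_swap Z Y, hs Z X, hs Z Y, hs Y X,
    map_neg, _root_.neg_apply] at h1 h2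
  rw [hg.symm x hx (Y x)]
  linarith

end levi_civita

/-! ### Almost contact metric and almost Kenmotsu structures -/

section structures

variable {x : M} {X Y Z : VectorFields n M} {U : Set M} {g : BilinFields n M}
  {φ : EndFields n M} {ξ : VectorFields n M} {η : OneForms n M} {α : ℝ} {t : M → ℝ}

namespace IsAlmostContactMetricOn

theorem metric_ξ_right (h : IsAlmostContactMetricOn φ ξ η g U) (hx : x ∈ U) (v : T n x) :
    g x v (ξ x) = η x v := by
  have := h.compat x hx v (ξ x)
  rw [h.φ_ξ x hx, map_zero, h.η_ξ x hx] at this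
  linarith

theorem metric_ξ_left (h : IsAlmostContactMetricOn φ ξ η g U) (hx : x ∈ U) (v : T n x) :
    g x (ξ x) v = η x v := by
  rw [h.metric.symm x hx, h.metric_ξ_right hx]

/-- `φ` is skew-adjoint. -/
theorem metric_φ (h : IsAlmostContactMetricOn φ ξ η g U) (hx : x ∈ U) (v w : T n x) :
    g x (φ x v) w = -g x v (φ x w) := by
  have := h.compat x hx v (φ x w)
  rw [h.φ_sq x hx, h.η_φ x hx, map_add, map_neg, map_smul, h.metric_ξ_right hx, h.η_φ x hx] at this
  simp only [smul_zero, mul_zero] at this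
  linarith

theorem mono (h : IsAlmostContactMetricOn φ ξ η g U) {V : Set M} (hV : V ⊆ U) :
    IsAlmostContactMetricOn φ ξ η g V where
  smooth_φ := ContMDiffOn.mono h.smooth_φ hV
  smooth_ξ := ContMDiffOn.mono h.smooth_ξ hV
  smooth_η := ContMDiffOn.mono h.smooth_η hV
  metric := ⟨ContMDiffOn.mono h.metric.smooth hV, fun x hx => h.metric.symm x (hV hx),
    fun x hx => h.metric.pos x (hV hx)⟩
  φ_sq x hx := h.φ_sq x (hV hx)
  η_ξ x hx := h.η_ξ x (hV hx)
  φ_ξ x hx := h.φ_ξ x (hV hx)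
  η_φ x hx := h.η_φ x (hV hx)
  compat x hx := h.compat x (hV hx)

end IsAlmostContactMetricOn

namespace IsAlmostKenmotsuOn

theorem mono (h : IsAlmostKenmotsuOn α φ ξ η g U) {V : Set M} (hV : V ⊆ U) :
    IsAlmostKenmotsuOn α φ ξ η g V where
  toIsAlmostContactMetricOn := h.toIsAlmostContactMetricOn.mono hV
  α_ne_zero := h.α_ne_zero
  dη x hx := h.dη x (hV hx)
  dΦ x hx := h.dΦ x (hV hx)

theorem η_bracket (h : IsAlmostKenmotsuOn α φ ξ η g U) (hx : x ∈ U) (hX : SmoothFieldAt X x)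
    (hY : SmoothFieldAt Y x) : η x (bracket X Y x)
      = dirDeriv X (fun y => η y (Y y)) x - dirDeriv Y (fun y => η y (X y)) x := by
  linarith [h.dη x hx X Y hX hY]

theorem η_bracket_ξ (h : IsAlmostKenmotsuOn α φ ξ η g U) (hU : IsOpen U) (hx : x ∈ U)
    (hX : SmoothFieldAt X x) :
    η x (bracket ξ X x) = dirDeriv ξ (fun y => η y (X y)) x := by
  rw [h.η_bracket hx (h.smooth_ξ.at hU hx) hX, dirDeriv_congr X (h := fun _ => 1)
    ((hU.eventually_mem hx).mono fun y hy => h.η_ξ y hy), dirDeriv_const, sub_zero]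

/-- The form `g(∇ξ, ·)` is half the Lie derivative of `g` along `ξ`, since `η` is closed. -/
theorem koszul_ξ (h : IsAlmostKenmotsuOn α φ ξ η g U) (hU : IsOpen U) (hx : x ∈ U)
    (hX : SmoothFieldAt X x) (hZ : SmoothFieldAt Z x) :
    koszul g X ξ Z x = dirDeriv ξ (fun y => g y (X y) (Z y)) x - g x (bracket ξ X x) (Z x)
      - g x (X x) (bracket ξ Z x) := by
  have e := hU.eventually_mem hx
  have h1 := h.η_bracket hx hX hZ
  rw [koszul, dirDeriv_congr X (e.mono fun y hy => h.metric_ξ_left hy (Z y)),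
    dirDeriv_congr Z (e.mono fun y hy => h.metric_ξ_right hy (X y)),
    dirDeriv_congr ξ (e.mono fun y hy => h.metric.symm y hy (Z y) (X y)),
    h.metric_ξ_right hx, bracket_swap X ξ, bracket_swap Z X, map_neg, map_neg, h1,
    h.metric.symm x hx (X x), _root_.neg_apply]
  ring

/-- This is L_ξΦ = 2αΦ. By Cartan's formula, i_ξΦ = 0 gives L_ξΦ = i_ξdΦ, and i_ξ(η∧Φ) = Φ. -/
theorem lieDeriv_metric_φ (h : IsAlmostKenmotsuOn α φ ξ η g U) (hU : IsOpen U) (hx : x ∈ U)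
    (hY : SmoothFieldAt Y x) (hZ : SmoothFieldAt Z x) :
    dirDeriv ξ (fun y => g y (Y y) (φ y (Z y))) x - g x (bracket ξ Y x) (φ x (Z x))
      - g x (Y x) (φ x (bracket ξ Z x)) = 2 * α * g x (Y x) (φ x (Z x)) := by
  have e := hU.eventually_mem hx
  have h1 := h.dΦ x hx ξ Y Z (h.smooth_ξ.at hU hx) hY hZ
  simp only [extDerivTwo, wedgeOneTwo, fundamentalForm] at h1
  rw [dirDeriv_congr Y (h := fun _ => 0) (e.mono fun y hy => by rw [h.φ_ξ y hy, map_zero]),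
    dirDeriv_congr Z (h := fun _ => 0)
      (e.mono fun y hy => by rw [h.metric_ξ_left hy, h.η_φ y hy]),
    dirDeriv_const, dirDeriv_const, h.φ_ξ x hx, map_zero, map_zero, h.η_ξ x hx,
    h.metric_ξ_left hx, h.η_φ x hx, bracket_swap Z ξ, map_neg, _root_.neg_apply,
    ← neg_eq_iff_eq_neg.2 (h.metric_φ hx (bracket ξ Z x) (Y x))] at h1
  rw [h.metric.symm x hx (Y x) (φ x (bracket ξ Z x))]
  linarith

theorem smooth_hPrime (h : IsAlmostKenmotsuOn α φ ξ η g U) (hU : IsOpen U) (hx : x ∈ U)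
    (hX : SmoothFieldAt X x) : SmoothFieldAt (hPrime α φ ξ X) x := by
  have hφX := h.smooth_φ.smooth_apply hU hx hX
  have hξ := h.smooth_ξ.at hU hx
  exact ((hξ.bracket (h.smooth_φ.smooth_apply hU hx hφX)).sub
    (h.smooth_φ.smooth_apply hU hx (hξ.bracket hφX))).const_smul _

/-- The covariant derivative of `ξ`, for smooth directions. -/
theorem leviCivita_ξ_of_smooth (h : IsAlmostKenmotsuOn α φ ξ η g U) (hU : IsOpen U) (hx : x ∈ U)
    (hX : SmoothFieldAt X x) :
    leviCivita g X ξ x = α • X x - (α * η x (X x)) • ξ x + α • hPrime α φ ξ X x := by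
  have e := hU.eventually_mem hx
  have hξ := h.smooth_ξ.at hU hx
  have hφX := h.smooth_φ.smooth_apply hU hx hX
  have hηX := h.smooth_η.smooth_apply hU hx hX
  refine leviCivita_eq_of_forall h.metric hx fun Z hZ => ?_
  have hηZ := h.smooth_η.smooth_apply hU hx hZ
  have hgZX := h.metric.smooth.smooth_apply hU hx hZ hX
  -- Inserting φX into L_ξΦ = 2αΦ brings in φ² = -I + η⊗ξ, so that L_ξg, which is 2g(∇ξ, ·), gets
  -- expressed through L_ξφ, that is through h'.
  have h1 := h.lieDeriv_metric_φ hU hx hZ hφX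
  have hα : α * (1 / (2 * α)) = 1 / 2 := by field_simp [h.α_ne_zero]
  have h2 : dirDeriv ξ (fun y => g y (Z y) (φ y (φ y (X y)))) x
      = η x (X x) * dirDeriv ξ (fun y => η y (Z y)) x
        + η x (Z x) * dirDeriv ξ (fun y => η y (X y)) x
        - dirDeriv ξ (fun y => g y (X y) (Z y)) x := by
    rw [dirDeriv_congr ξ (h := fun y => η y (X y) * η y (Z y) - g y (Z y) (X y))
      (e.mono fun y hy => by
        rw [h.φ_sq y hy, map_add, map_neg, map_smul, h.metric_ξ_right hy, smul_eq_mul]; ring),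
      dirDeriv_sub ξ (hηX.diff.mul hηZ.diff) hgZX.diff, dirDeriv_mul ξ hηX.diff hηZ.diff,
      dirDeriv_congr ξ (e.mono fun y hy => h.metric.symm y hy (Z y) (X y))]
  have h3 : bracket ξ (fun y => φ y (φ y (X y))) x
      = -bracket ξ X x + dirDeriv ξ (fun y => η y (X y)) x • ξ x := by
    have hN : DiffFieldAt ((fun _ : M => (-1 : ℝ)) • X) x :=
      DiffFieldAt.smul (diffFunAt_const (-1)) hX.diff
    have hP : DiffFieldAt ((fun y => η y (X y)) • ξ) x := DiffFieldAt.smul hηX.diff hξ.diff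
    rw [bracket_congr_right ξ (Z := (fun _ : M => (-1 : ℝ)) • X + (fun y => η y (X y)) • ξ)
      (e.mono fun y hy => by simp [h.φ_sq y hy]), bracket_add_right hN hP,
      bracket_smul_right (diffFunAt_const _) hX.diff, bracket_smul_right hηX.diff hξ.diff,
      dirDeriv_const]
    simp [bracket]
  have hk := h.koszul_ξ hU hx hX hZ
  rw [hk]
  rw [h2, h.φ_sq x hx] at h1
  simp only [hPrime, lieDerivEnd, h3, map_add, map_sub, map_smul, _root_.add_apply,
    _root_.sub_apply, _root_.smul_apply, smul_eq_mul, map_neg, _root_.neg_apply,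
    h.metric_ξ_left hx, h.metric_ξ_right hx, h.η_bracket_ξ hU hx hZ] at h1 ⊢
  rw [h.metric.symm x hx (Z x) (X x), h.metric.symm x hx (Z x) (φ x _),
    h.metric.symm x hx (bracket ξ Z x)] at h1
  linear_combination h1 + 2 * (-g x (bracket ξ X x) (Z x)
    + dirDeriv ξ (fun y => η y (X y)) x * η x (Z x)
    - g x (φ x (bracket ξ (fun y => φ y (X y)) x)) (Z x)) * hα

end IsAlmostKenmotsuOn

end structures

/-! ### The operator h', the covariant derivative of ξ, and curvature under the conformal change -/

section curvature

variable {x : M} {X Y Z : VectorFields n M} {U : Set M} {g : BilinFields n M}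
  {φ : EndFields n M} {ξ : VectorFields n M} {η : OneForms n M} {α : ℝ} {t : M → ℝ}

namespace IsAlmostKenmotsuOn

/-- The two brackets in L_ξφ each contribute (ξf)φ²X, with opposite signs. -/
theorem tensorialAt_hPrime (h : IsAlmostKenmotsuOn α φ ξ η g U) (hU : IsOpen U) (hx : x ∈ U) :
    TensorialAt 𝓘(ℝ, Model n) (Model n) (fun X : VectorFields n M => hPrime α φ ξ X x) x where
  smul {f X} hf hX := by
    have h1 := h.smooth_φ.diff_apply hU hx hX
    have h2 := h.smooth_φ.diff_apply hU hx h1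
    have e1 : (fun y => φ y (φ y ((f • X) y))) = f • fun y => φ y (φ y (X y)) := by
      ext; simp
    have e2 : (fun y => φ y ((f • X) y)) = f • fun y => φ y (X y) := by
      ext; simp
    simp only [hPrime, lieDerivEnd, e1]
    rw [e2, bracket_smul_right hf h1, bracket_smul_right hf h2]
    simp only [map_add, map_smul]
    module
  add {X X'} hX hX' := by
    have h1 := h.smooth_φ.diff_apply hU hx hX
    have h2 := h.smooth_φ.diff_apply hU hx h1
    have h1' := h.smooth_φ.diff_apply hU hx hX'
    have h2' := h.smooth_φ.diff_apply hU hx h1'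
    have e1 : (fun y => φ y (φ y ((X + X') y)))
        = (fun y => φ y (φ y (X y))) + fun y => φ y (φ y (X' y)) := by
      ext; simp
    have e2 : (fun y => φ y ((X + X') y)) = (fun y => φ y (X y)) + fun y => φ y (X' y) := by
      ext; simp
    simp only [hPrime, lieDerivEnd, e1]
    rw [e2, bracket_add_right h1 h1', bracket_add_right h2 h2']
    simp only [map_add]
    module

/-- The covariant derivative of `ξ`. -/
theorem leviCivita_ξ (h : IsAlmostKenmotsuOn α φ ξ η g U) (hU : IsOpen U) (hx : x ∈ U)
    (hX : DiffFieldAt X x) :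
    leviCivita g X ξ x = α • X x - (α * η x (X x)) • ξ x + α • hPrime α φ ξ X x := by
  obtain ⟨X', hX', h0⟩ := exists_smoothFieldAt (X x)
  rw [leviCivita_congr_first h.metric hU hx hX hX'.diff (h.smooth_ξ.at hU hx).diff h0.symm,
    h.leviCivita_ξ_of_smooth hU hx hX', h0,
    (h.tensorialAt_hPrime hU hx).pointwise hX'.diff hX h0]

/-- The field ξ has constant length 1. -/
theorem η_leviCivita_ξ (h : IsAlmostKenmotsuOn α φ ξ η g U) (hU : IsOpen U) (hx : x ∈ U)
    (hX : DiffFieldAt X x) : η x (leviCivita g X ξ x) = 0 := by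
  have hξ := (h.smooth_ξ.at hU hx).diff
  have h1 := dirDeriv_metric h.metric hU hx hX hξ hξ
  rw [dirDeriv_congr X (h := fun _ => 1) ((hU.eventually_mem hx).mono fun y hy => by
    rw [h.metric_ξ_left hy, h.η_ξ y hy]), dirDeriv_const, h.metric_ξ_left hx,
    h.metric_ξ_right hx] at h1
  linarith

theorem η_hPrime (h : IsAlmostKenmotsuOn α φ ξ η g U) (hU : IsOpen U) (hx : x ∈ U)
    (hX : DiffFieldAt X x) : η x (hPrime α φ ξ X x) = 0 := by
  have h1 := h.η_leviCivita_ξ hU hx hX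
  rw [h.leviCivita_ξ hU hx hX] at h1
  simp only [map_add, map_sub, map_smul, smul_eq_mul, h.η_ξ x hx] at h1
  have h2 : α * η x (hPrime α φ ξ X x) = 0 := by linear_combination h1
  exact (mul_eq_zero.1 h2).resolve_left h.α_ne_zero

/-- `h'` is self-adjoint. -/
theorem metric_hPrime (h : IsAlmostKenmotsuOn α φ ξ η g U) (hU : IsOpen U) (hx : x ∈ U)
    (hX : SmoothFieldAt X x) (hY : SmoothFieldAt Y x) :
    g x (hPrime α φ ξ X x) (Y x) = g x (hPrime α φ ξ Y x) (X x) := by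
  have hξ := (h.smooth_ξ.at hU hx).diff
  -- The form g(∇_Xξ, Y) is half of L_ξg, hence symmetric; the other terms of ∇ξ are visibly
  -- symmetric, so h' is too after dividing by α.
  have h1 := two_mul_leviCivita h.metric hU hx hX.diff hξ hY.diff
  have h2 := two_mul_leviCivita h.metric hU hx hY.diff hξ hX.diff
  rw [h.leviCivita_ξ hU hx hX.diff, h.koszul_ξ hU hx hX hY] at h1
  rw [h.leviCivita_ξ hU hx hY.diff, h.koszul_ξ hU hx hY hX, dirDeriv_congr ξ
    ((hU.eventually_mem hx).mono fun y hy => h.metric.symm y hy (Y y) (X y)),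
    h.metric.symm x hx (Y x), h.metric.symm x hx (bracket ξ Y x)] at h2
  simp only [map_add, map_sub, map_smul, _root_.add_apply, _root_.sub_apply, _root_.smul_apply,
    smul_eq_mul, h.metric_ξ_left hx, h.metric.symm x hx (Y x) (X x)] at h1 h2
  refine mul_left_cancel₀ (mul_ne_zero two_ne_zero h.α_ne_zero) ?_
  linear_combination h1 - h2

end IsAlmostKenmotsuOn

/-! ### The conformal change -/

omit [IsManifold 𝓘(ℝ, Model n) ∞ M] in
theorem conformalChange_apply (α : ℝ) (t : M → ℝ) (η : OneForms n M) (g : BilinFields n M) (x : M)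
    (v w : T n x) : conformalChange α t η g x v w
      = Real.exp (-2 * α * t x) * g x v w + (1 - Real.exp (-2 * α * t x)) * (η x v * η x w) := by
  simp [conformalChange]

omit [IsManifold 𝓘(ℝ, Model n) ∞ M] in
theorem IsPrimitiveOn.smoothFunAt (ht : IsPrimitiveOn t η U) (hU : IsOpen U) (hx : x ∈ U) :
    SmoothFunAt n t x :=
  ht.1.contMDiffAt (hU.mem_nhds hx)

omit [IsManifold 𝓘(ℝ, Model n) ∞ M] in
theorem smoothFunAt_exp (α : ℝ) (ht : SmoothFunAt n t x) :
    SmoothFunAt n (fun y => Real.exp (-2 * α * t y)) x := by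
  have h1 : ContDiff ℝ ∞ fun s : ℝ => Real.exp (-2 * α * s) := by fun_prop
  exact ContMDiffAt.comp (g := fun s : ℝ => Real.exp (-2 * α * s)) x h1.contMDiff.contMDiffAt ht

omit [IsManifold 𝓘(ℝ, Model n) ∞ M] in
theorem IsPrimitiveOn.dirDeriv_exp (ht : IsPrimitiveOn t η U) (hU : IsOpen U) (hx : x ∈ U) :
    dirDeriv X (fun y => Real.exp (-2 * α * t y)) x
      = -2 * α * Real.exp (-2 * α * t x) * η x (X x) := by
  have h1 : HasDerivAt (fun s : ℝ => Real.exp (-2 * α * s))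
      (Real.exp (-2 * α * t x) * (-2 * α)) (t x) := by
    simpa using ((hasDerivAt_id (t x)).const_mul (-2 * α)).exp
  have h2 := mvfderiv_comp_apply (g := fun s : ℝ => Real.exp (-2 * α * s)) (f := t) x
    h1.differentiableAt.mdifferentiableAt (ht.smoothFunAt hU hx).diff (X x)
  have h3 : ∀ v : ℝ, mvfderiv 𝓘(ℝ, ℝ) (fun s : ℝ => Real.exp (-2 * α * s)) (t x) v
      = v * (Real.exp (-2 * α * t x) * (-2 * α)) := fun v => by
    rw [mvfderiv, mfderiv_eq_fderiv, h1.hasFDerivAt.fderiv]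
    rfl
  rw [← ht.2 x hx]
  refine (h2 : dirDeriv X (fun y => Real.exp (-2 * α * t y)) x = _).trans ?_
  refine (h3 _).trans ?_
  change mvfderiv 𝓘(ℝ, Model n) t x (X x) * _ = _
  ring

/-- In a trivialization the coordinates of η⊗η are a fixed quadratic, hence smooth, function of
those of η. -/
theorem smoothBilinAt_smulRight
    (hη : ContMDiffAt 𝓘(ℝ, Model n) (𝓘(ℝ, Model n).prod 𝓘(ℝ, Model n →L[ℝ] ℝ)) ∞
      (fun y => TotalSpace.mk' (Model n →L[ℝ] ℝ) (E := fun y : M => T n y →L[ℝ] ℝ) y (η y)) x) :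
    ContMDiffAt 𝓘(ℝ, Model n) (𝓘(ℝ, Model n).prod 𝓘(ℝ, Model n →L[ℝ] Model n →L[ℝ] ℝ)) ∞
      (fun y => TotalSpace.mk' (Model n →L[ℝ] Model n →L[ℝ] ℝ)
        (E := fun y : M => T n y →L[ℝ] T n y →L[ℝ] ℝ) y ((η y).smulRight (η y))) x := by
  rw [contMDiffAt_hom_bundle] at hη ⊢
  refine ⟨contMDiffAt_id, ?_⟩
  have h1 := hη.2
  have h2 : ContDiff ℝ ∞ fun l : Model n →L[ℝ] ℝ => l.smulRight l := by
    fun_prop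
  refine (ContMDiffAt.comp (g := fun l : Model n →L[ℝ] ℝ => l.smulRight l) x
    h2.contMDiff.contMDiffAt h1).congr_of_eventuallyEq ?_
  have hb := (trivializationAt (Model n) (T n) x).open_baseSet.mem_nhds
    (FiberBundle.mem_baseSet_trivializationAt (Model n) (T n) x)
  filter_upwards [hb] with y hy
  ext v w
  rw [inCoordinates_apply_eq₂ (F₁ := Model n) (F₂ := Model n) (F₃ := ℝ)
    (E₁ := fun y : M => T n y) (E₂ := fun y : M => T n y) (E₃ := fun _ : M => ℝ) hy hy
    (by simp)]
  have hs : ∀ u : Model n, (trivializationAt (Model n) (T n) x).symmL ℝ y u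
      = (trivializationAt (Model n) (T n) x).symm y u := 
    fun u => Trivialization.symmL_apply _ hy u
  simp [ContinuousLinearMap.inCoordinates, hs]

theorem smoothBilinOn_conformalChange (hg : SmoothBilinOn g U) (hη : SmoothOneFormOn η U)
    (hU : IsOpen U) (ht : IsPrimitiveOn t η U) : SmoothBilinOn (conformalChange α t η g) U := by
  intro x hx
  have hE := smoothFunAt_exp α (ht.smoothFunAt hU hx)
  have h1 : SmoothFunAt n (fun y => 1 - Real.exp (-2 * α * t y)) x :=
    ContMDiffAt.sub contMDiffAt_const hE
  refine ContMDiffAt.contMDiffWithinAt ?_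
  exact (ContMDiffAt.smul_section hE (ContMDiffOn.contMDiffAt hg (hU.mem_nhds hx))).add_section
    (ContMDiffAt.smul_section h1 (smoothBilinAt_smulRight
      (ContMDiffOn.contMDiffAt hη (hU.mem_nhds hx))))

namespace IsAlmostKenmotsuOn

theorem isAlmostContactMetricOn_conformalChange (h : IsAlmostKenmotsuOn α φ ξ η g U)
    (hU : IsOpen U) (ht : IsPrimitiveOn t η U) :
    IsAlmostContactMetricOn φ ξ η (conformalChange α t η g) U where
  smooth_φ := h.smooth_φ
  smooth_ξ := h.smooth_ξ
  smooth_η := h.smooth_η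
  metric :=
    { smooth := smoothBilinOn_conformalChange h.metric.smooth h.smooth_η hU ht
      symm := fun x hx v w => by
        rw [conformalChange_apply, conformalChange_apply, h.metric.symm x hx, mul_comm (η x v)]
      pos := fun x hx v hv => by
        have h0 := Real.exp_pos (-2 * α * t x)
        have h1 := h.compat x hx v v
        rw [conformalChange_apply]
        -- One has g'(v, v) = E g(φv, φv) + η(v)². If φv = 0, then η(v)² = g(v, v) > 0; otherwise
        -- the first summand is positive.
        by_cases hφ : φ x v = 0
        · rw [hφ, map_zero] at h1
          have h2 := h.metric.pos x hx v hv
          nlinarith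
        · have h2 := mul_pos h0 (h.metric.pos x hx _ hφ)
          rw [h1] at h2
          nlinarith [mul_self_nonneg (η x v)] }
  φ_sq := h.φ_sq
  η_ξ := h.η_ξ
  φ_ξ := h.φ_ξ
  η_φ := h.η_φ
  compat x hx v w := by
    rw [conformalChange_apply, conformalChange_apply, h.compat x hx, h.η_φ x hx, h.η_φ x hx]
    ring

theorem isAlmostCosymplecticOn_conformalChange (h : IsAlmostKenmotsuOn α φ ξ η g U)
    (hU : IsOpen U) (ht : IsPrimitiveOn t η U) :
    IsAlmostCosymplecticOn φ ξ η (conformalChange α t η g) U where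
  toIsAlmostContactMetricOn := h.isAlmostContactMetricOn_conformalChange hU ht
  dη := h.dη
  dΦ x hx X Y Z hX hY hZ := by
    have e := hU.eventually_mem hx
    have h1 := h.dΦ x hx X Y Z hX hY hZ
    -- The η⊗η part of g' does not contribute because η∘φ = 0.
    have hΦ : ∀ y ∈ U, ∀ v w : T n y, fundamentalForm φ (conformalChange α t η g) y v w
        = Real.exp (-2 * α * t y) * fundamentalForm φ g y v w := fun y hy v w => by
      simp only [fundamentalForm, conformalChange_apply, h.η_φ y hy]
      ring
    have hE := (smoothFunAt_exp α (ht.smoothFunAt hU hx)).diff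
    have hd : ∀ V W Z : VectorFields n M, SmoothFieldAt V x → SmoothFieldAt W x →
        dirDeriv Z (fun y => fundamentalForm φ (conformalChange α t η g) y (V y) (W y)) x
          = Real.exp (-2 * α * t x) * dirDeriv Z (fun y => fundamentalForm φ g y (V y) (W y)) x
            + fundamentalForm φ g x (V x) (W x)
              * (-2 * α * Real.exp (-2 * α * t x) * η x (Z x)) := fun V W Z hV hW => by
      have hVW : DiffFunAt n (fun y => fundamentalForm φ g y (V y) (W y)) x :=
        (h.metric.smooth.smooth_apply hU hx hV (h.smooth_φ.smooth_apply hU hx hW)).diff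
      rw [dirDeriv_congr Z (e.mono fun y hy => hΦ y hy (V y) (W y)),
        dirDeriv_mul Z hE hVW, ht.dirDeriv_exp hU hx]
    simp only [extDerivTwo, wedgeOneTwo] at h1 ⊢
    rw [hd Y Z X hY hZ, hd Z X Y hZ hX, hd X Y Z hX hY, hΦ x hx, hΦ x hx, hΦ x hx]
    linear_combination Real.exp (-2 * α * t x) * h1

/-- Closedness of η collapses the Koszul expression of η⊗η to 2η(Z)X(η(Y)). The last group of terms
comes from differentiating E, which multiplies g - η⊗η. -/
theorem koszul_conformalChange (h : IsAlmostKenmotsuOn α φ ξ η g U) (hU : IsOpen U) (hx : x ∈ U)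
    (ht : IsPrimitiveOn t η U) (hX : SmoothFieldAt X x) (hY : SmoothFieldAt Y x)
    (hZ : SmoothFieldAt Z x) :
    koszul (conformalChange α t η g) X Y Z x
      = Real.exp (-2 * α * t x) * koszul g X Y Z x
        + 2 * (1 - Real.exp (-2 * α * t x)) * (η x (Z x) * dirDeriv X (fun y => η y (Y y)) x)
        - 2 * α * Real.exp (-2 * α * t x) *
          (η x (X x) * (g x (Y x) (Z x) - η x (Y x) * η x (Z x))
            + η x (Y x) * (g x (Z x) (X x) - η x (Z x) * η x (X x))
            - η x (Z x) * (g x (X x) (Y x) - η x (X x) * η x (Y x))) := by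
  have hE := (smoothFunAt_exp α (ht.smoothFunAt hU hx)).diff
  have hd : ∀ V W Z : VectorFields n M, SmoothFieldAt V x → SmoothFieldAt W x →
      dirDeriv Z (fun y => conformalChange α t η g y (V y) (W y)) x
        = Real.exp (-2 * α * t x) * dirDeriv Z (fun y => g y (V y) (W y)) x
          + (1 - Real.exp (-2 * α * t x)) * (η x (V x) * dirDeriv Z (fun y => η y (W y)) x
            + η x (W x) * dirDeriv Z (fun y => η y (V y)) x)
          - 2 * α * Real.exp (-2 * α * t x) * η x (Z x)
            * (g x (V x) (W x) - η x (V x) * η x (W x)) := fun V W Z hV hW => by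
    have hVW := (h.metric.smooth.smooth_apply hU hx hV hW).diff
    have hηV := (h.smooth_η.smooth_apply hU hx hV).diff
    have hηW := (h.smooth_η.smooth_apply hU hx hW).diff
    have h1 : DiffFunAt n (fun y => 1 - Real.exp (-2 * α * t y)) x :=
      MDifferentiableAt.sub (diffFunAt_const 1) hE
    simp only [conformalChange_apply]
    rw [dirDeriv_add Z (hE.mul hVW) (h1.mul (hηV.mul hηW)), dirDeriv_mul Z hE hVW,
      dirDeriv_mul Z h1 (hηV.mul hηW), dirDeriv_mul Z hηV hηW,
      dirDeriv_sub Z (diffFunAt_const 1) hE, dirDeriv_const, ht.dirDeriv_exp hU hx]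
    ring
  simp only [koszul]
  rw [hd Y Z X hY hZ, hd Z X Y hZ hX, hd X Y Z hX hY, conformalChange_apply, conformalChange_apply,
    conformalChange_apply, h.η_bracket hx hX hY, h.η_bracket hx hY hZ, h.η_bracket hx hZ hX]
  ring

/-- The Levi-Civita connection of the conformally changed metric. -/
theorem leviCivita_conformalChange (h : IsAlmostKenmotsuOn α φ ξ η g U) (hU : IsOpen U)
    (hx : x ∈ U) (ht : IsPrimitiveOn t η U) (hX : SmoothFieldAt X x) (hY : SmoothFieldAt Y x) :
    leviCivita (conformalChange α t η g) X Y x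
      = leviCivita g X Y x - (α * η x (X x)) • Y x - (α * η x (Y x)) • X x
        + ((1 - Real.exp (-2 * α * t x))
            * (dirDeriv X (fun y => η y (Y y)) x - η x (leviCivita g X Y x))
          + α * Real.exp (-2 * α * t x) * (g x (X x) (Y x) - η x (X x) * η x (Y x))
          + 2 * α * (η x (X x) * η x (Y x))) • ξ x := by
  refine leviCivita_eq_of_forall (h.isAlmostContactMetricOn_conformalChange hU ht).metric hx
    fun Z hZ => ?_
  have h1 := two_mul_leviCivita h.metric hU hx hX.diff hY.diff hZ.diff
  rw [h.koszul_conformalChange hU hx ht hX hY hZ, conformalChange_apply]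
  simp only [map_add, map_sub, map_smul, _root_.add_apply, _root_.sub_apply, _root_.smul_apply,
    smul_eq_mul, h.metric_ξ_left hx, h.η_ξ x hx]
  rw [h.metric.symm x hx (Z x) (X x)]
  linear_combination Real.exp (-2 * α * t x) * h1

/-- The correction -αη(ξ)X removes the term αX of ∇_Xξ. Three multiples of αη(X)ξ remain, with
coefficients -1, -1 and 2. -/
theorem leviCivita_conformalChange_ξ (h : IsAlmostKenmotsuOn α φ ξ η g U) (hU : IsOpen U)
    (hx : x ∈ U) (ht : IsPrimitiveOn t η U) (hX : DiffFieldAt X x) :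
    leviCivita (conformalChange α t η g) X ξ x = α • hPrime α φ ξ X x := by
  have hξ := h.smooth_ξ.at hU hx
  obtain ⟨X', hX', h0⟩ := exists_smoothFieldAt (X x)
  rw [leviCivita_congr_first (h.isAlmostContactMetricOn_conformalChange hU ht).metric hU hx hX
    hX'.diff hξ.diff h0.symm, h.leviCivita_conformalChange hU hx ht hX' hξ,
    dirDeriv_congr X' (h := fun _ => 1) ((hU.eventually_mem hx).mono fun y hy => h.η_ξ y hy),
    dirDeriv_const, h.η_leviCivita_ξ hU hx hX'.diff, h.leviCivita_ξ hU hx hX'.diff,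
    h.metric_ξ_right hx, h.η_ξ x hx, (h.tensorialAt_hPrime hU hx).pointwise hX'.diff hX h0]
  module

/-- The difference of the curvatures in the direction of `ξ`. -/
theorem curvature_conformalChange (h : IsAlmostKenmotsuOn α φ ξ η g U) (hU : IsOpen U)
    (hx : x ∈ U) (ht : IsPrimitiveOn t η U) (hX : SmoothFieldAt X x) (hY : SmoothFieldAt Y x) :
    curvature (conformalChange α t η g) X Y ξ x = curvature g X Y ξ x
      + α ^ 2 • (η x (Y x) • X x - η x (X x) • Y x)
      + (2 * α ^ 2) • (η x (Y x) • hPrime α φ ξ X x - η x (X x) • hPrime α φ ξ Y x) := by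
  have hξ := h.smooth_ξ.at hU hx
  have e := hU.eventually_mem hx
  have hXY := hX.bracket hY
  -- Both expansions keep the derivative ∇_V(αh'W) unevaluated: it cancels in the difference of the
  -- curvatures.
  have key' : ∀ V W : VectorFields n M, SmoothFieldAt V x → SmoothFieldAt W x →
      leviCivita (conformalChange α t η g) V (leviCivita (conformalChange α t η g) W ξ) x
        = leviCivita g V (fun y => α • hPrime α φ ξ W y) x
          - (α ^ 2 * η x (V x)) • hPrime α φ ξ W x
          + ((1 - Real.exp (-2 * α * t x)) * (α ^ 2 * g x (hPrime α φ ξ W x) (V x)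
            + α ^ 2 * g x (hPrime α φ ξ V x) (hPrime α φ ξ W x))
            + α ^ 2 * Real.exp (-2 * α * t x) * g x (hPrime α φ ξ W x) (V x)) • ξ x := by
    intro V W hV hW
    have hH := (h.smooth_hPrime hU hx hW).const_smul α
    have h0 : ∀ᶠ y in 𝓝 x, η y (α • hPrime α φ ξ W y) = 0 :=
      (e.and hW.eventually_diff).mono fun y hy => by
        rw [map_smul, h.η_hPrime hU hy.1 hy.2, smul_zero]
    -- Differentiating g(αh'W, ξ) = 0 along V gives the ξ-component of ∇_V(αh'W).
    have h1 := dirDeriv_metric h.metric hU hx hV.diff hH.diff hξ.diff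
    rw [dirDeriv_congr V (h := fun _ => 0) ((e.and h0).mono fun y hy => by
      rw [h.metric_ξ_right hy.1, hy.2]), dirDeriv_const, h.metric_ξ_right hx,
      h.leviCivita_ξ hU hx hV.diff] at h1
    simp only [map_add, map_sub, map_smul, _root_.smul_apply, smul_eq_mul, h.metric_ξ_right hx,
      h.η_hPrime hU hx hW.diff] at h1
    rw [leviCivita_congr_second _ V ((e.and hW.eventually_diff).mono fun y hy =>
      h.leviCivita_conformalChange_ξ hU hy.1 ht hy.2),
      h.leviCivita_conformalChange hU hx ht hV hH, dirDeriv_congr V h0, dirDeriv_const,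
      h0.self_of_nhds]
    have h2 : η x (leviCivita g V (fun y => α • hPrime α φ ξ W y) x)
        = -(α ^ 2 * g x (hPrime α φ ξ W x) (V x)
          + α ^ 2 * g x (hPrime α φ ξ V x) (hPrime α φ ξ W x)) := by
      rw [h.metric.symm x hx (hPrime α φ ξ V x)]
      linear_combination -h1
    rw [h2, map_smul, h.metric.symm x hx (V x), smul_eq_mul]
    module
  have key : ∀ V W : VectorFields n M, SmoothFieldAt V x → SmoothFieldAt W x →
      leviCivita g V (leviCivita g W ξ) x
        = α • leviCivita g V W x + leviCivita g V (fun y => α • hPrime α φ ξ W y) x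
          - (α * η x (W x)) • (α • V x - (α * η x (V x)) • ξ x + α • hPrime α φ ξ V x)
          - (α * dirDeriv V (fun y => η y (W y)) x) • ξ x := by
    intro V W hV hW
    have hH := (h.smooth_hPrime hU hx hW).const_smul α
    have hηW := (h.smooth_η.smooth_apply hU hx hW).diff
    have hc := (diffFunAt_const (n := n) (x := x) (-α)).mul hηW
    have h1 : DiffFieldAt (fun y => (-α * η y (W y)) • ξ y) x := DiffFieldAt.smul hc hξ.diff
    have h2 : DiffFieldAt (fun y => α • W y) x := DiffFieldAt.smul (diffFunAt_const α) hW.diff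
    rw [leviCivita_congr_second _ V (Y' := fun y => (α • W y + (-α * η y (W y)) • ξ y)
      + α • hPrime α φ ξ W y) ((e.and hW.eventually_diff).mono fun y hy => by
        rw [h.leviCivita_ξ hU hy.1 hy.2]; module),
      leviCivita_add h.metric hU hx hV.diff (h2.add h1) hH.diff,
      leviCivita_add h.metric hU hx hV.diff h2 h1,
      leviCivita_smul h.metric hU hx hV.diff (diffFunAt_const α) hW.diff,
      leviCivita_smul h.metric hU hx hV.diff hc hξ.diff,
      dirDeriv_mul V (diffFunAt_const (-α)) hηW, dirDeriv_const, dirDeriv_const,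
      h.leviCivita_ξ hU hx hV.diff]
    module
  have htor := leviCivita_sub_leviCivita h.metric hU hx hX.diff hY.diff
  have hsa : g x (hPrime α φ ξ X x) (Y x) = g x (hPrime α φ ξ Y x) (X x) :=
    h.metric_hPrime hU hx hX hY
  -- Self-adjointness of h' makes the ξ-coefficients of the second derivatives for g' symmetric in X
  -- and Y. Zero torsion matches the terms α∇_XY - α∇_YX with the contribution of [X, Y].
  rw [curvature, curvature, key' X Y hX hY, key' Y X hY hX, key X Y hX hY, key Y X hY hX,
    h.leviCivita_conformalChange_ξ hU hx ht hXY.diff, h.leviCivita_ξ hU hx hXY.diff,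
    h.η_bracket hx hX hY, hsa, h.metric.symm x hx (hPrime α φ ξ X x), ← htor]
  module

end IsAlmostKenmotsuOn

end curvature

/-! ### Local primitives of closed forms -/

section primitive

/-- The vector field that is constant equal to `u` in the chart at `p`. -/
def coordField (p : M) (u : Model n) : VectorFields n M := fun x =>
  (mfderiv 𝓘(ℝ, Model n) 𝓘(ℝ, Model n) (extChartAt 𝓘(ℝ, Model n) p) x).inverse u

/-- A constant vector field on the model space. -/
def constField (u : Model n) : (z : Model n) → TangentSpace 𝓘(ℝ, Model n) z := fun _ => u

variable {η : OneForms n M} {p x : M}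

theorem mfderiv_extChartAt_coordField (hx : x ∈ (extChartAt 𝓘(ℝ, Model n) p).source)
    (u : Model n) :
    mfderiv 𝓘(ℝ, Model n) 𝓘(ℝ, Model n) (extChartAt 𝓘(ℝ, Model n) p) x (coordField p u x) = u :=
  (isInvertible_mfderiv_extChartAt hx).self_apply_inverse u

theorem coordField_mfderiv_extChartAt (hx : x ∈ (extChartAt 𝓘(ℝ, Model n) p).source)
    (v : T n x) :
    coordField p
      (mfderiv 𝓘(ℝ, Model n) 𝓘(ℝ, Model n) (extChartAt 𝓘(ℝ, Model n) p) x v) x = v :=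
  (isInvertible_mfderiv_extChartAt hx).inverse_apply_self v

omit [IsManifold 𝓘(ℝ, Model n) ∞ M] in
theorem coordField_eq_mpullback (p : M) (u : Model n) :
    coordField p u = VectorField.mpullback 𝓘(ℝ, Model n) 𝓘(ℝ, Model n)
      (extChartAt 𝓘(ℝ, Model n) p) (constField u) := rfl

theorem smoothFieldAt_coordField (hx : x ∈ (extChartAt 𝓘(ℝ, Model n) p).source) (u : Model n) :
    SmoothFieldAt (coordField p u) x := by
  have h0 : ContDiffAt ℝ ∞ (fun _ : Model n => u) (extChartAt 𝓘(ℝ, Model n) p x) :=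
    contDiffAt_const
  have : IsManifold 𝓘(ℝ, Model n) ((∞ : ℕ∞ω) + 1) M := by simpa using ‹_›
  exact ContMDiffAt.mpullback_vectorField_preimage (n := ∞) (V := constField u)
    (contMDiffAt_vectorSpace_iff_contDiffAt.2 h0) (contMDiffAt_extChartAt' (by simpa using hx))
    (isInvertible_mfderiv_extChartAt hx) (by simp)

/-- Pullback commutes with the Lie bracket, and constant fields commute. -/
theorem bracket_coordField (hx : x ∈ (extChartAt 𝓘(ℝ, Model n) p).source) (u v : Model n) :
    bracket (coordField p u) (coordField p v) x = 0 := by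
  have h0 : ∀ w : Model n, MDifferentiableAt 𝓘(ℝ, Model n) 𝓘(ℝ, Model n).tangent
      (fun z => (⟨z, constField w z⟩ : TangentBundle 𝓘(ℝ, Model n) (Model n)))
      (extChartAt 𝓘(ℝ, Model n) p x) := fun w =>
    ContMDiffAt.mdifferentiableAt (n := 1) (contMDiffAt_vectorSpace_iff_contDiffAt.2
      (contDiffAt_const : ContDiffAt ℝ 1 (fun _ : Model n => w) _)) (by simp)
  have h1 : ContMDiffAt 𝓘(ℝ, Model n) 𝓘(ℝ, Model n) ∞ (extChartAt 𝓘(ℝ, Model n) p) x :=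
    contMDiffAt_extChartAt' (by simpa using hx)
  have h2 := VectorField.mpullback_mlieBracket (h0 u) (h0 v) h1 (by simpa using ENat.LEInfty.out)
  have h3 : VectorField.mlieBracket 𝓘(ℝ, Model n) (constField u) (constField v)
      (extChartAt 𝓘(ℝ, Model n) p x) = 0 := by
    rw [← VectorField.mlieBracketWithin_univ, VectorField.mlieBracketWithin_eq_lieBracketWithin]
    unfold constField
    simp [VectorField.lieBracketWithin]
    rfl
  rw [bracket, coordField_eq_mpullback, coordField_eq_mpullback, ← h2, VectorField.mpullback_apply,
    h3, map_zero]

theorem mvfderiv_comp_extChartAt (hx : x ∈ (extChartAt 𝓘(ℝ, Model n) p).source)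
    {F : Model n → ℝ} (hF : DifferentiableAt ℝ F (extChartAt 𝓘(ℝ, Model n) p x)) (v : T n x) :
    mvfderiv 𝓘(ℝ, Model n) (F ∘ extChartAt 𝓘(ℝ, Model n) p) x v
      = fderiv ℝ F (extChartAt 𝓘(ℝ, Model n) p x)
        (mfderiv 𝓘(ℝ, Model n) 𝓘(ℝ, Model n) (extChartAt 𝓘(ℝ, Model n) p) x v) := by
  have h1 : ContMDiffAt 𝓘(ℝ, Model n) 𝓘(ℝ, Model n) ∞ (extChartAt 𝓘(ℝ, Model n) p) x :=
    contMDiffAt_extChartAt' (by simpa using hx)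
  refine (mvfderiv_comp_apply x hF.mdifferentiableAt (h1.mdifferentiableAt (by simp)) v).trans ?_
  rw [mvfderiv, mfderiv_eq_fderiv]
  rfl

/-- A closed `1`-form is locally exact. -/
theorem exists_isPrimitiveOn (hη : SmoothOneFormOn η univ) (hd : IsClosedOneFormOn η univ)
    (p : M) : ∃ U : Set M, IsOpen U ∧ p ∈ U ∧ ∃ t : M → ℝ, IsPrimitiveOn t η U := by
  set e := extChartAt 𝓘(ℝ, Model n) p with he
  obtain ⟨r, hr, hB⟩ := Metric.isOpen_iff.1 (isOpen_extChartAt_target (I := 𝓘(ℝ, Model n)) p) (e p)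
    (mem_extChartAt_target p)
  set B := Metric.ball (e p) r
  have hBo : IsOpen B := Metric.isOpen_ball
  have hsymm : ContMDiffOn 𝓘(ℝ, Model n) 𝓘(ℝ, Model n) ∞ e.symm B :=
    (contMDiffOn_extChartAt_symm p).mono hB
  have hsrc : ∀ z ∈ B, e.symm z ∈ e.source := fun z hz => e.map_target (hB hz)
  -- The form η read in the chart; its value on u is the value of η on the coordinate field of u.
  let θ : Model n → Model n →L[ℝ] ℝ := fun z =>
    (η (e.symm z)).comp (mfderiv 𝓘(ℝ, Model n) 𝓘(ℝ, Model n) e (e.symm z)).inverse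
  have hθ : ∀ z u, θ z u = η (e.symm z) (coordField p u (e.symm z)) := fun _ _ => rfl
  have hθs : ContDiffOn ℝ ∞ θ B := by
    rw [contDiffOn_clm_apply]
    intro u
    rw [← contMDiffOn_iff_contDiffOn]
    exact fun z hz => ContMDiffAt.comp_contMDiffWithinAt z (hη.smooth_apply isOpen_univ (mem_univ _)
      (smoothFieldAt_coordField (hsrc z hz) u)) (hsymm z hz)
  have hθd : DifferentiableOn ℝ θ B := hθs.differentiableOn (by simp)
  have hderiv : ∀ z ∈ B, ∀ u v, fderiv ℝ θ z u v
      = dirDeriv (coordField p u) (fun y => η y (coordField p v y)) (e.symm z) := by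
    intro z hz u v
    have hez : e (e.symm z) = z := e.right_inv (hB hz)
    have h1 := hθd.differentiableAt (hBo.mem_nhds hz)
    have h2 : HasFDerivAt (fun z => θ z v) ((fderiv ℝ θ z).flip v) z := by
      simpa using h1.hasFDerivAt.clm_apply (hasFDerivAt_const v z)
    rw [dirDeriv_congr (h := (fun z => θ z v) ∘ e) _
      (Filter.mem_of_superset ((isOpen_extChartAt_source p).mem_nhds (hsrc z hz)) fun y hy => by
        change _ = θ (e y) v
        rw [hθ, e.left_inv hy]), dirDeriv,
      mvfderiv_comp_extChartAt (hsrc z hz) (by rw [← he, hez]; exact h2.differentiableAt),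
      mfderiv_extChartAt_coordField (hsrc z hz), ← he, hez, h2.fderiv]
    rfl
  -- Poincaré lemma on the convex ball. On commuting coordinate fields the bracket term of dη
  -- vanishes, so dη = 0 says that the derivative of θ is symmetric.
  obtain ⟨F, hF⟩ := (convex_ball (e p) r).exists_forall_hasFDerivAt_of_fderiv_symmetric hBo hθd
    fun z hz u v => by
      have h1 := hd (e.symm z) (mem_univ _) _ _ (smoothFieldAt_coordField (hsrc z hz) u)
        (smoothFieldAt_coordField (hsrc z hz) v)
      rw [bracket_coordField (hsrc z hz), map_zero, ← hderiv z hz, ← hderiv z hz] at h1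
      linarith
  have hFs : ContDiffOn ℝ ∞ F B := by
    rw [contDiffOn_infty_iff_fderiv_of_isOpen hBo]
    exact ⟨fun z hz => (hF z hz).differentiableAt.differentiableWithinAt,
      hθs.congr fun z hz => (hF z hz).fderiv⟩
  refine ⟨e.source ∩ e ⁻¹' B, isOpen_extChartAt_preimage' p hBo,
    ⟨mem_extChartAt_source p, Metric.mem_ball_self hr⟩, F ∘ e, ?_, ?_⟩
  · exact hFs.contMDiffOn.comp ((contMDiffOn_extChartAt (x := p)).mono fun x hx => by
      simpa [e] using hx.1) fun x hx => hx.2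
  · rintro x ⟨hx, hxB⟩
    ext v
    rw [mvfderiv_comp_extChartAt hx (hF _ hxB).differentiableAt, ← he, (hF _ hxB).fderiv]
    refine (hθ _ _).trans ?_
    rw [e.left_inv hx, coordField_mfderiv_extChartAt hx]

end primitive

end AlmostContact

end

theorem mainTheorem10 {n : ℕ} {M : Type*} [TopologicalSpace M] [T2Space M]
    [ChartedSpace (AlmostContact.Model n) M]
    [IsManifold 𝓘(ℝ, AlmostContact.Model n) ∞ M]
    (φ : AlmostContact.EndFields n M) (ξ : AlmostContact.VectorFields n M)
    (η : AlmostContact.OneForms n M) (g : AlmostContact.BilinFields n M)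
    (α κ μ : ℝ)
    (hK : AlmostContact.IsAlmostKenmotsuOn α φ ξ η g Set.univ)
    (hh : ∃ (x : M) (X : AlmostContact.VectorFields n M),
      AlmostContact.SmoothFieldAt X x ∧ AlmostContact.hPrime α φ ξ X x ≠ 0)
    (hN : AlmostContact.InKMNullityOn κ μ α φ ξ η g Set.univ)
    (hμ : μ = -2 * α ^ 2) :
    (∀ p : M, ∃ U : Set M, IsOpen U ∧ p ∈ U ∧
      ∃ t : M → ℝ, AlmostContact.IsPrimitiveOn t η U) ∧
    ∀ U : Set M, IsOpen U → ∀ t : M → ℝ, AlmostContact.IsPrimitiveOn t η U →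
      AlmostContact.IsAlmostCosymplecticOn φ ξ η (AlmostContact.conformalChange α t η g) U ∧
      AlmostContact.InNullityOn (κ + α ^ 2) ξ (AlmostContact.conformalChange α t η g) U := by
  refine ⟨AlmostContact.exists_isPrimitiveOn hK.smooth_η hK.dη, fun U hU t ht => ?_⟩
  have hK' := hK.mono (subset_univ U)
  have hc := hK'.isAlmostCosymplecticOn_conformalChange hU ht
  refine ⟨hc, fun x hx X Y hX hY => ?_⟩
  -- Since g'(·, ξ) = η, the target is an identity in η alone; the h' terms have total coefficient μ
  -- + 2α² = 0.
  rw [hK'.curvature_conformalChange hU hx ht hX hY, hN x (mem_univ x) X Y hX hY,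
    hc.metric_ξ_right hx, hc.metric_ξ_right hx, hμ]
  module
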